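/- Let $X$ be a separable real Banach space with dual $X'$. For $\beta\ge 1$ let $\boldsymbol\mu_\beta=\bigotimes_{j\ge1}\mathcal N_\beta(0,1)$ be the product probability measure on $\mathbb R^{\mathbb N}$ whose factors have the density $$\varphi_\beta(y)=\frac{1}{2\beta^{1/\beta}\Gamma(1+\frac1\beta)}\,e^{-|y|^\beta/\beta},\qquad y\in\mathbb R.$$ Let $\boldsymbol\alpha=(\alpha_j)_{j\ge1}\in\ell^1(\mathbb N)$ with $\alpha_j\ge0$ for all $j$ and $\|\boldsymbol\alpha\|_\infty<1$, and put $U_{\boldsymbol\alpha}=\{\boldsymbol y\in\mathbb R^{\mathbb N}:\sum_{j\ge1}\alpha_j|y_j|<\infty\}$. Let $p\in(0,1)$, let $\boldsymbol b=(b_j)_{j\ge1}\in\ell^p(\mathbb N)$ with $b_1\ge b_2\ge\cdots\ge0$, let $(\Theta_\ell)_{\ell\ge0}$ be a sequence of nonnegative numbers, and put $k=\lceil\frac1{1-p}\rceil$. Then there is a constant $C>0$, depending only on $\boldsymbol\alpha$, $\boldsymbol b$, $p$ and $(\Theta_\ell)_{\ell\ge0}$, and in particular not on $\beta$ or $s$,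 with the following property. Let $\beta\ge1$ and let $g:U_{\boldsymbol\alpha}\to X$; for $s\ge1$ write $g_s(\boldsymbol y)=g(y_1,\ldots,y_s,0,0,\ldots)$. Suppose that (A1) $\|g(\boldsymbol y)-g_s(\boldsymbol y)\|_X\to0$ as $s\to\infty$ for $\boldsymbol\mu_\beta$-almost every $\boldsymbol y\in U_{\boldsymbol\alpha}$; (A2) $g$ is continuously differentiable up to order $k+1$ on $U_{\boldsymbol\alpha}$ (it is enough that this holds with respect to every finite set of variables, the other variables being fixed), and $$\|\partial^{\boldsymbol\nu}g(\boldsymbol y)\|_X\le\Theta_{|\boldsymbol\nu|}\,\prod_{j\ge1}b_j^{\nu_j}\,\prod_{j\ge1}e^{\alpha_j|y_j|}$$ for all $\boldsymbol y\in U_{\boldsymbol\alpha}$ and all multi-indices $\boldsymbol\nu\in\mathbb N_0^{\mathbb N}$ with $|\boldsymbol\nu|=\sum_{j\ge1}\nu_j\le k+1$ (with $0^0=1$). Then, for every integer $s\ge1$, the function $g-g_s$ is $\boldsymbol\mu_\beta$-integrable, $$\bigg\|\int_{\mathbb R^{\mathbb N}}(g(\boldsymbol y)-g_s(\boldsymbol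 y))\,\boldsymbol\mu_\beta(\mathrm d\boldsymbol y)\bigg\|_X\le C\,s^{-\frac2p+1},$$ and, for every $G\in X'$, $$\bigg|\int_{\mathbb R^{\mathbb N}}G(g(\boldsymbol y)-g_s(\boldsymbol y))\,\boldsymbol\mu_\beta(\mathrm d\boldsymbol y)\bigg|\le C\,\|G\|_{X'}\,s^{-\frac2p+1}.$$ (Here $\boldsymbol\mu_\beta(U_{\boldsymbol\alpha})=1$, so the values of the integrands outside $U_{\boldsymbol\alpha}$ are irrelevant.) -/

import Mathlib

open MeasureTheory Filter Topology

noncomputable section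

/-- The density `φ_β` of the univariate `β`-Gaussian distribution. -/
def betaGaussianPDF (β y : ℝ) : ℝ :=
  1 / (2 * β ^ (1 / β) * Real.Gamma (1 + 1 / β)) * Real.exp (-(|y| ^ β / β))

/-- The univariate `β`-Gaussian distribution on `ℝ`. -/
def betaGaussian (β : ℝ) : Measure ℝ :=
  (volume : Measure ℝ).withDensity fun y => ENNReal.ofReal (betaGaussianPDF β y)

theorem lintegral_betaGaussianPDF {β : ℝ} (hβ : 0 < β) :
    ∫⁻ y, ENNReal.ofReal (betaGaussianPDF β y) = 1 := by
  have hΓ : 0 < Real.Gamma (1 + 1 / β) := Real.Gamma_pos_of_pos (by positivity)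
  have hpow : 0 < β ^ (1 / β) := Real.rpow_pos_of_pos hβ _
  have hfun : ∀ y : ℝ, betaGaussianPDF β y =
      1 / (2 * β ^ (1 / β) * Real.Gamma (1 + 1 / β)) * Real.exp (-β⁻¹ * |y| ^ β) := by
    intro y
    unfold betaGaussianPDF
    congr 2
    ring
  have hint : ∫ y, betaGaussianPDF β y = 1 := by
    simp_rw [hfun]
    rw [integral_const_mul, integral_comp_abs (f := fun x => Real.exp (-β⁻¹ * x ^ β)),
      integral_exp_neg_mul_rpow hβ (inv_pos.mpr hβ)]
    have h1 : β⁻¹ ^ (-1 / β) = β ^ (1 / β) := by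
      rw [Real.inv_rpow hβ.le, ← Real.rpow_neg hβ.le]
      congr 1
      ring
    rw [h1, add_comm (1 / β) 1]
    field_simp
  have hI : Integrable (betaGaussianPDF β) := by
    by_contra h
    rw [integral_undef h] at hint
    exact zero_ne_one hint
  rw [← ofReal_integral_eq_lintegral_ofReal hI, hint, ENNReal.ofReal_one]
  refine Eventually.of_forall fun y => ?_
  rw [hfun]
  positivity

/-- For `β > 0` the `β`-Gaussian distribution is a probability measure. -/
theorem isProbabilityMeasure_betaGaussian {β : ℝ} (hβ : 0 < β) :
    IsProbabilityMeasure (betaGaussian β) :=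
  ⟨by simp [betaGaussian, lintegral_betaGaussianPDF hβ]⟩

/-- The product measure `μ_β = ⨂_{j ≥ 1} N_β(0,1)` on `ℝ^ℕ`. Throughout, coordinates are indexed
from `0`: the coordinate `y_{j+1}` of the mathematical text is `y j`. -/
def betaGaussianProd (β : ℝ) : Measure (ℕ → ℝ) :=
  Measure.infinitePi fun _ => betaGaussian β

/-- The set `U_α` of all `y ∈ ℝ^ℕ` with `∑_j α_j |y_j| < ∞` (for nonnegative `α`). -/
def weightedSet (α : ℕ → ℝ) : Set (ℕ → ℝ) :=
  {y | Summable fun j => α j * |y j|}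

/-- `truncateSeq s y = (y_1, …, y_s, 0, 0, …)`. -/
def truncateSeq (s : ℕ) (y : ℕ → ℝ) : ℕ → ℝ :=
  fun j => if j < s then y j else 0

/-- `replaceFirst n y x = (x_1, …, x_n, y_{n+1}, y_{n+2}, …)`. -/
def replaceFirst (n : ℕ) (y : ℕ → ℝ) (x : Fin n → ℝ) : ℕ → ℝ :=
  fun j => if h : j < n then x ⟨j, h⟩ else y j

variable {X : Type*} [NormedAddCommGroup X] [NormedSpace ℝ X]

/-- The partial derivative `∂g/∂y_j`. -/
def seqPartial (j : ℕ) (g : (ℕ → ℝ) → X) : (ℕ → ℝ) → X :=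
  fun y => lineDeriv ℝ g y (Pi.single j 1)

/-- The mixed partial derivative `∂^ν g` for a finitely supported multi-index `ν`: each index `j`
is listed `ν j` times in increasing order and the partial derivatives are applied successively. -/
def mixedPartial (ν : ℕ →₀ ℕ) (g : (ℕ → ℝ) → X) : (ℕ → ℝ) → X :=
  ((Finsupp.toMultiset ν).sort (· ≤ ·)).foldr seqPartial g

/-- `g` is `m` times continuously differentiable on `U_α` in every finite set of variables, the
remaining variables being frozen. The set `U_α` is stable under changing finitely many coordinates,
so that only the values of `g` on `U_α` matter. -/
def ContDiffInVariables (m : ℕ) (α : ℕ → ℝ) (g : (ℕ → ℝ) → X) : Prop :=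
  ∀ y ∈ weightedSet α, ∀ n : ℕ, ContDiff ℝ m fun x : Fin n → ℝ => g (replaceFirst n y x)

/-- `‖g(y) - g_s(y)‖ → 0` as `s → ∞`, for `μ_β`-almost every `y ∈ U_α`. -/
def TruncationConverges (β : ℝ) (α : ℕ → ℝ) (g : (ℕ → ℝ) → X) : Prop :=
  ∀ᵐ y ∂(betaGaussianProd β), y ∈ weightedSet α →
    Tendsto (fun s : ℕ => ‖g y - g (truncateSeq s y)‖) atTop (𝓝 0)

/-- Parametric regularity up to order `m`: `g` is `m` times continuously differentiable on `U_α`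
and `‖∂^ν g(y)‖ ≤ Θ_{|ν|} b^ν ∏_j exp(α_j |y_j|)` for all `y ∈ U_α` and all `|ν| ≤ m`. -/
structure ParametricRegularity (m : ℕ) (α b Θ : ℕ → ℝ) (g : (ℕ → ℝ) → X) : Prop where
  contDiff : ContDiffInVariables m α g
  bound : ∀ y ∈ weightedSet α, ∀ ν : ℕ →₀ ℕ, ν.degree ≤ m →
    ‖mixedPartial ν g y‖ ≤
      Θ ν.degree * (ν.prod fun j n => b j ^ n) * ∏' j, Real.exp (α j * |y j|)

end

/-! Write `g - g_s` as the telescoping sum over `n ≥ s` of `d_n = g_{n+1} - g_n`. Each `d_n`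
vanishes when `y_n = 0`, and its part linear in `y_n` is odd, so it integrates to zero under the
symmetric factor measure. Averaging `d_n` with its reflection in `y_n` gives half a symmetric second
difference, which costs `b_n ^ 2` rather than `b_n`
(`ParametricRegularity.norm_integral_succ_sub_le`). Summing `b_n ^ 2` over `n ≥ s` gives the rate
(`sum_sq_tail_le`).

Uniformity in `β` comes from one exponential majorant for all the densities (`betaGaussianPDF_le`).
It bounds the expected weights independently of `β` and `n` (`exists_lintegral_truncWeight_le`). The
supremum of the weights is then integrable and justifies the limit by dominated convergence. -/

/-! ### Univariate bounds uniform in `β`, and symmetry. -/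

theorem measurable_betaGaussianPDF (β : ℝ) : Measurable (betaGaussianPDF β) := by
  unfold betaGaussianPDF
  fun_prop

/-- On `[0, 1]` the density is at least `c * exp (-1)`, and its total mass is 1. -/
theorem betaGaussianPDF_zero_le_exp {β : ℝ} (hβ : 1 ≤ β) :
    1 / (2 * β ^ (1 / β) * Real.Gamma (1 + 1 / β)) ≤ Real.exp 1 := by
  have hβ0 : 0 < β := by linarith
  set c := 1 / (2 * β ^ (1 / β) * Real.Gamma (1 + 1 / β)) with hc
  have hΓ : 0 < Real.Gamma (1 + 1 / β) := Real.Gamma_pos_of_pos (by positivity)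
  have hc0 : 0 ≤ c := by positivity
  have h1 : ENNReal.ofReal (c * Real.exp (-1)) ≤ 1 := by
    calc ENNReal.ofReal (c * Real.exp (-1))
        = ∫⁻ _ in Set.Icc (0 : ℝ) 1, ENNReal.ofReal (c * Real.exp (-1)) := by simp
      _ ≤ ∫⁻ y in Set.Icc (0 : ℝ) 1, ENNReal.ofReal (betaGaussianPDF β y) := by
          refine setLIntegral_mono ((measurable_betaGaussianPDF β).ennreal_ofReal) fun y hy => ?_
          refine ENNReal.ofReal_le_ofReal ?_
          unfold betaGaussianPDF
          rw [← hc]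
          gcongr
          have h2 : |y| ^ β ≤ 1 :=
            Real.rpow_le_one (abs_nonneg y) (by rw [abs_of_nonneg hy.1]; exact hy.2) hβ0.le
          rw [div_le_one hβ0]
          linarith
      _ ≤ ∫⁻ y, ENNReal.ofReal (betaGaussianPDF β y) := setLIntegral_le_lintegral _ _
      _ = 1 := lintegral_betaGaussianPDF hβ0
  rw [ENNReal.ofReal_le_one, Real.exp_neg, ← div_eq_mul_inv, div_le_one (Real.exp_pos 1)] at h1
  exact h1

/-- Bernoulli's inequality at `1 + (|y| - 1)` gives `|y| ^ β / β ≥ |y| - 1`. One factor `e` comes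
from this shift, the other from the normalising constant. -/
theorem betaGaussianPDF_le {β : ℝ} (hβ : 1 ≤ β) (y : ℝ) :
    betaGaussianPDF β y ≤ Real.exp 2 * Real.exp (-|y|) := by
  have hβ0 : 0 < β := by linarith
  have h : |y| - 1 ≤ |y| ^ β / β := by
    have h1 := one_add_mul_self_le_rpow_one_add (s := |y| - 1)
      (by linarith [abs_nonneg y]) hβ
    rw [add_sub_cancel] at h1
    rw [le_div_iff₀ hβ0]
    linarith
  calc betaGaussianPDF β y ≤ Real.exp 1 * Real.exp (1 - |y|) := by
        unfold betaGaussianPDF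
        gcongr
        · exact betaGaussianPDF_zero_le_exp hβ
        · linarith
    _ = Real.exp 2 * Real.exp (-|y|) := by
        rw [← Real.exp_add, ← Real.exp_add]
        congr 1
        ring

theorem integrable_exp_neg_mul_abs {c : ℝ} (hc : 0 < c) :
    Integrable fun y : ℝ => Real.exp (-c * |y|) := by
  have hint : ∫ y : ℝ, Real.exp (-c * |y|) ≠ 0 := by
    rw [integral_comp_abs (f := fun x => Real.exp (-c * x))]
    have := integral_exp_neg_mul_rpow one_pos hc
    simp only [Real.rpow_one] at this
    rw [this]
    have : 0 < Real.Gamma (1 / 1 + 1) := Real.Gamma_pos_of_pos (by norm_num)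
    positivity
  -- A nonintegrable function has Bochner integral 0 by convention, so a nonzero value proves
  -- integrability.
  exact not_imp_comm.mp integral_undef hint

theorem lintegral_betaGaussian_le {β : ℝ} (hβ : 1 ≤ β) {f : ℝ → ENNReal} (hf : Measurable f) :
    ∫⁻ y, f y ∂(betaGaussian β) ≤
      ∫⁻ y, ENNReal.ofReal (Real.exp 2 * Real.exp (-|y|)) * f y := by
  rw [betaGaussian, lintegral_withDensity_eq_lintegral_mul _
    (measurable_betaGaussianPDF β).ennreal_ofReal hf]
  refine lintegral_mono fun y => ?_
  simp only [Pi.mul_apply]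
  gcongr
  exact betaGaussianPDF_le hβ y

/-- Exponential moments below the critical exponent are bounded uniformly in `β ≥ 1`. -/
theorem exists_lintegral_exp_betaGaussian_le {r : ℝ} (hr : r < 1) :
    ∃ M : ℝ, 0 ≤ M ∧ ∀ β : ℝ, 1 ≤ β →
      ∫⁻ y, ENNReal.ofReal (Real.exp (r * |y|)) ∂(betaGaussian β) ≤ ENNReal.ofReal M := by
  have hI := (integrable_exp_neg_mul_abs (c := 1 - r) (by linarith)).const_mul (Real.exp 2)
  refine ⟨∫ y, Real.exp 2 * Real.exp (-(1 - r) * |y|),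
    integral_nonneg fun y => by positivity, fun β hβ => ?_⟩
  refine (lintegral_betaGaussian_le hβ (by fun_prop)).trans (le_of_eq ?_)
  rw [ofReal_integral_eq_lintegral_ofReal hI (Eventually.of_forall fun y => by positivity)]
  refine lintegral_congr fun y => ?_
  rw [← ENNReal.ofReal_mul (by positivity), mul_assoc, ← Real.exp_add]
  congr 3
  ring

theorem lintegral_ofReal_le_of_le_exp {ν : Measure ℝ} {f : ℝ → ℝ} {c r M : ℝ} (hc : 0 ≤ c)
    (hM : ∫⁻ y, ENNReal.ofReal (Real.exp (r * |y|)) ∂ν ≤ ENNReal.ofReal M)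
    (hf : ∀ y, f y ≤ c * Real.exp (r * |y|)) :
    ∫⁻ y, ENNReal.ofReal (f y) ∂ν ≤ ENNReal.ofReal (c * M) := by
  calc ∫⁻ y, ENNReal.ofReal (f y) ∂ν
      ≤ ∫⁻ y, ENNReal.ofReal c * ENNReal.ofReal (Real.exp (r * |y|)) ∂ν := by
        refine lintegral_mono fun y => ?_
        rw [← ENNReal.ofReal_mul hc]
        exact ENNReal.ofReal_le_ofReal (hf y)
    _ = ENNReal.ofReal c * ∫⁻ y, ENNReal.ofReal (Real.exp (r * |y|)) ∂ν :=
        lintegral_const_mul _ (by fun_prop)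
    _ ≤ ENNReal.ofReal (c * M) := by
        rw [ENNReal.ofReal_mul hc]
        gcongr

/-- This is `exp u ≤ 1 + u * exp u`. The excess over 1 is linear in `t`, so that with `t = α j` the
product over `j` is controlled by `∑ α j`. -/
theorem exp_mul_le_one_add {t a x : ℝ} (ht : 0 ≤ t) (hta : t ≤ a) (hx : 0 ≤ x) :
    Real.exp (t * x) ≤ 1 + t * (x * Real.exp (a * x)) := by
  have h1 : 1 - t * x ≤ Real.exp (-(t * x)) := Real.one_sub_le_exp_neg (t * x)
  have h2 : Real.exp (t * x) * Real.exp (-(t * x)) = 1 := by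
    rw [← Real.exp_add, add_neg_cancel, Real.exp_zero]
  have h3 : Real.exp (t * x) ≤ Real.exp (a * x) := by gcongr
  have h4 := mul_le_mul_of_nonneg_left h1 (Real.exp_pos (t * x)).le
  have h5 := mul_le_mul_of_nonneg_left h3 (mul_nonneg ht hx)
  nlinarith

/-- Weighted moments of the `β`-Gaussian distribution, bounded uniformly in `β ≥ 1`. -/
theorem exists_betaGaussian_moments_le {a : ℝ} (ha : a < 1) :
    ∃ K : ℝ, 0 ≤ K ∧ ∀ β : ℝ, 1 ≤ β →
      ∀ t : ℝ, 0 ≤ t → t ≤ a →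
        ∫⁻ y, ENNReal.ofReal (Real.exp (t * |y|)) ∂(betaGaussian β) ≤
          ENNReal.ofReal (Real.exp (t * K)) ∧
        ∫⁻ y, ENNReal.ofReal (y ^ 2 * Real.exp (t * |y|)) ∂(betaGaussian β) ≤
          ENNReal.ofReal K := by
  -- Half the gap to the critical exponent: `exp (δ * |y|)` absorbs the polynomial factors while `a
  -- + δ < 1` still holds.
  set δ := (1 - a) / 2 with hδ
  have hδ0 : 0 < δ := by rw [hδ]; linarith
  obtain ⟨M, hM0, hM⟩ := exists_lintegral_exp_betaGaussian_le (r := a + δ) (by rw [hδ]; linarith)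
  have hlin : ∀ y : ℝ, |y| * Real.exp (a * |y|) ≤ δ⁻¹ * Real.exp ((a + δ) * |y|) := fun y => by
    have h1 : δ * |y| ≤ Real.exp (δ * |y|) := by linarith [Real.add_one_le_exp (δ * |y|)]
    rw [add_mul, Real.exp_add, mul_comm (Real.exp _), ← mul_assoc]
    gcongr
    rw [inv_mul_eq_div, le_div_iff₀ hδ0]
    linarith
  have hsq : ∀ y : ℝ, y ^ 2 * Real.exp (a * |y|) ≤
      2 * (δ ^ 2)⁻¹ * Real.exp ((a + δ) * |y|) := fun y => by
    have h1 : (δ * |y|) ^ 2 / 2 ≤ Real.exp (δ * |y|) := by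
      have := Real.quadratic_le_exp_of_nonneg (x := δ * |y|) (by positivity)
      have : 0 ≤ δ * |y| := by positivity
      linarith
    rw [mul_pow, sq_abs] at h1
    rw [add_mul, Real.exp_add, mul_comm (Real.exp _), ← mul_assoc]
    gcongr
    rw [mul_assoc, inv_mul_eq_div, ← mul_div_assoc, le_div_iff₀ (by positivity)]
    linarith
  have h1 : 0 ≤ δ⁻¹ * M := by positivity
  have h2 : 0 ≤ 2 * (δ ^ 2)⁻¹ * M := by positivity
  refine ⟨δ⁻¹ * M + 2 * (δ ^ 2)⁻¹ * M, by positivity, fun β hβ t ht hta => ⟨?_, ?_⟩⟩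
  · have := isProbabilityMeasure_betaGaussian (β := β) (by linarith)
    calc ∫⁻ y, ENNReal.ofReal (Real.exp (t * |y|)) ∂(betaGaussian β)
        ≤ ∫⁻ y, (1 + ENNReal.ofReal t * ENNReal.ofReal (|y| * Real.exp (a * |y|)))
            ∂(betaGaussian β) := by
          refine lintegral_mono fun y => ?_
          rw [← ENNReal.ofReal_mul ht, ← ENNReal.ofReal_one,
            ← ENNReal.ofReal_add zero_le_one (by positivity)]
          exact ENNReal.ofReal_le_ofReal (exp_mul_le_one_add ht hta (abs_nonneg y))
      _ = 1 + ENNReal.ofReal t * ∫⁻ y, ENNReal.ofReal (|y| * Real.exp (a * |y|))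
            ∂(betaGaussian β) := by
          rw [lintegral_add_left measurable_const, lintegral_const_mul _ (by fun_prop)]
          simp
      _ ≤ 1 + ENNReal.ofReal t * ENNReal.ofReal (δ⁻¹ * M) := by
          gcongr
          exact lintegral_ofReal_le_of_le_exp (by positivity) (hM β hβ) hlin
      _ = ENNReal.ofReal (1 + t * (δ⁻¹ * M)) := by
          rw [← ENNReal.ofReal_mul ht, ← ENNReal.ofReal_one,
            ← ENNReal.ofReal_add zero_le_one (by positivity)]
      _ ≤ _ := by
          refine ENNReal.ofReal_le_ofReal ?_
          have h3 := Real.add_one_le_exp (t * (δ⁻¹ * M + 2 * (δ ^ 2)⁻¹ * M))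
          have h4 := mul_nonneg ht h2
          linarith
  · refine (lintegral_ofReal_le_of_le_exp (by positivity) (hM β hβ) (c := 2 * (δ ^ 2)⁻¹)
      fun y => ?_).trans (ENNReal.ofReal_le_ofReal (by linarith))
    refine le_trans ?_ (hsq y)
    gcongr

/-- The `β`-Gaussian distribution is symmetric. -/
theorem betaGaussian_map_neg (β : ℝ) :
    (betaGaussian β).map (fun x => -x) = betaGaussian β := by
  ext s hs
  rw [Measure.map_apply measurable_neg hs, betaGaussian, withDensity_apply _ hs,
    withDensity_apply _ (measurable_neg hs), ← lintegral_indicator hs,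
    ← lintegral_indicator (measurable_neg hs)]
  refine Eq.trans (lintegral_congr fun y => ?_) (lintegral_neg_eq_self _)
  simp only [Set.indicator, Set.mem_preimage, betaGaussianPDF, abs_neg]
  rfl

/-! ### Weights on the product space, and reflection of one coordinate. -/

/-- The weight `∏_{j < n} exp (α_j |y_j|)`. -/
noncomputable def truncWeight (α : ℕ → ℝ) (n : ℕ) (y : ℕ → ℝ) : ℝ :=
  Real.exp (∑ j ∈ Finset.range n, α j * |y j|)

theorem truncWeight_pos (α : ℕ → ℝ) (n : ℕ) (y : ℕ → ℝ) : 0 < truncWeight α n y :=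
  Real.exp_pos _

theorem measurable_truncWeight (α : ℕ → ℝ) (n : ℕ) : Measurable (truncWeight α n) := by
  unfold truncWeight
  fun_prop

theorem truncWeight_mono {α : ℕ → ℝ} (hα : ∀ j, 0 ≤ α j) (y : ℕ → ℝ) :
    Monotone fun n => truncWeight α n y := by
  refine monotone_nat_of_le_succ fun n => Real.exp_le_exp.mpr ?_
  rw [Finset.sum_range_succ]
  exact le_add_of_nonneg_right (mul_nonneg (hα n) (abs_nonneg _))

theorem truncWeight_succ_update (α : ℕ → ℝ) (n : ℕ) (y : ℕ → ℝ) (x : ℝ) :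
    truncWeight α (n + 1) (Function.update y n x) = truncWeight α n y * Real.exp (α n * |x|) := by
  unfold truncWeight
  rw [Finset.sum_range_succ, Real.exp_add, Function.update_self]
  congr 2
  refine Finset.sum_congr rfl fun j hj => ?_
  rw [Function.update_of_ne (Finset.mem_range.mp hj).ne]

theorem truncateSeq_mem_weightedSet (α : ℕ → ℝ) (n : ℕ) (y : ℕ → ℝ) :
    truncateSeq n y ∈ weightedSet α := by
  refine summable_of_ne_finset_zero (s := Finset.range n) fun j hj => ?_
  simp [truncateSeq, Finset.mem_range.not.mp hj]

theorem tprod_exp_truncateSeq (α : ℕ → ℝ) (n : ℕ) (y : ℕ → ℝ) :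
    ∏' j, Real.exp (α j * |truncateSeq n y j|) = truncWeight α n y := by
  rw [tprod_eq_prod (s := Finset.range n), truncWeight, Real.exp_sum]
  · refine Finset.prod_congr rfl fun j hj => ?_
    rw [truncateSeq, if_pos (Finset.mem_range.mp hj)]
  · intro j hj
    simp [truncateSeq, Finset.mem_range.not.mp hj]

theorem lintegral_betaGaussianProd_prod {β : ℝ} (hβ : 1 ≤ β) (s : Finset ℕ)
    {f : ℕ → ℝ → ENNReal} (hf : ∀ j, Measurable (f j)) :
    ∫⁻ y, ∏ j ∈ s, f j (y j) ∂(betaGaussianProd β) = ∏ j ∈ s, ∫⁻ x, f j x ∂(betaGaussian β) := by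
  have := isProbabilityMeasure_betaGaussian (β := β) (by linarith)
  unfold betaGaussianProd
  refine (ProbabilityTheory.lintegral_prod_eq_prod_lintegral_of_indepFun s
    (fun j (y : ℕ → ℝ) => f j (y j)) (ProbabilityTheory.iIndepFun_infinitePi hf) fun j =>
      (hf j).comp (measurable_pi_apply j)).trans ?_
  refine Finset.prod_congr rfl fun j _ => ?_
  conv_rhs => rw [← Measure.infinitePi_map_eval (fun _ : ℕ => betaGaussian β) j]
  exact (lintegral_map (hf j) (measurable_pi_apply j)).symm

theorem lintegral_truncWeight_mul {β : ℝ} (hβ : 1 ≤ β) (α : ℕ → ℝ) (n : ℕ) {f : ℝ → ENNReal}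
    (hf : Measurable f) :
    ∫⁻ y, ENNReal.ofReal (truncWeight α n y) * f (y n) ∂(betaGaussianProd β) =
      (∏ j ∈ Finset.range n, ∫⁻ x, ENNReal.ofReal (Real.exp (α j * |x|)) ∂(betaGaussian β)) *
        ∫⁻ x, f x ∂(betaGaussian β) := by
  have h := lintegral_betaGaussianProd_prod hβ (Finset.range (n + 1))
    (f := fun j => if j = n then f else fun x => ENNReal.ofReal (Real.exp (α j * |x|)))
    (fun j => by split_ifs <;> fun_prop)
  simp only [Finset.prod_range_succ, if_true] at h
  have hne : ∀ j ∈ Finset.range n, j ≠ n := fun j hj => (Finset.mem_range.mp hj).ne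
  rw [Finset.prod_congr rfl (fun j hj => by rw [if_neg (hne j hj)])] at h
  rw [← h]
  refine lintegral_congr fun y => ?_
  congr 1
  rw [truncWeight, Real.exp_sum, ENNReal.ofReal_prod_of_nonneg fun _ _ => (Real.exp_pos _).le]
  exact Finset.prod_congr rfl fun j hj => by rw [if_neg (hne j hj)]

theorem prod_ofReal_exp_le {α : ℕ → ℝ} (hα : ∀ j, 0 ≤ α j) (hsum : Summable α) {K : ℝ}
    (hK : 0 ≤ K) {m : ℕ → ENNReal} (hm : ∀ j, m j ≤ ENNReal.ofReal (Real.exp (α j * K))) (n : ℕ) :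
    ∏ j ∈ Finset.range n, m j ≤ ENNReal.ofReal (Real.exp ((∑' j, α j) * K)) := by
  calc ∏ j ∈ Finset.range n, m j
      ≤ ∏ j ∈ Finset.range n, ENNReal.ofReal (Real.exp (α j * K)) :=
        Finset.prod_le_prod' fun j _ => hm j
    _ = ENNReal.ofReal (Real.exp ((∑ j ∈ Finset.range n, α j) * K)) := by
        rw [Finset.sum_mul, Real.exp_sum,
          ENNReal.ofReal_prod_of_nonneg fun _ _ => (Real.exp_pos _).le]
    _ ≤ _ := by
        gcongr
        exact hsum.sum_le_tsum _ fun j _ => hα j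

/-- Uniformly in `β ≥ 1` and `n`, the weight `∏_{j < n} exp (α_j |y_j|)` has bounded expectation,
and so does `y_n² ∏_{j ≤ n} exp (α_j |y_j|)`. -/
theorem exists_lintegral_truncWeight_le {α : ℕ → ℝ} (hα : ∀ j, 0 ≤ α j) (hsum : Summable α)
    (hsup : ⨆ j, |α j| < 1) :
    ∃ E : ℝ, 0 ≤ E ∧ ∀ β : ℝ, 1 ≤ β → ∀ n : ℕ,
      ∫⁻ y, ENNReal.ofReal (truncWeight α n y) ∂(betaGaussianProd β) ≤ ENNReal.ofReal E ∧
      ∫⁻ y, ENNReal.ofReal (truncWeight α n y * Real.exp (α n * |y n|) * y n ^ 2)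
        ∂(betaGaussianProd β) ≤ ENNReal.ofReal E := by
  -- A real supremum bounds its family only when the family is bounded; summability provides this.
  have hbdd : BddAbove (Set.range fun j => |α j|) := hsum.abs.tendsto_atTop_zero.bddAbove_range
  have hle : ∀ j, α j ≤ ⨆ j, |α j| := fun j => (le_abs_self _).trans (le_ciSup hbdd j)
  obtain ⟨K, hK, hmom⟩ := exists_betaGaussian_moments_le hsup
  set P := Real.exp ((∑' j, α j) * K) with hP
  have hP0 : 0 ≤ P := (Real.exp_pos _).le
  have hPK : 0 ≤ P * K := by positivity
  refine ⟨P + P * K, by positivity, fun β hβ n => ?_⟩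
  have hprod := prod_ofReal_exp_le hα hsum hK
    (fun j => (hmom β hβ (α j) (hα j) (hle j)).1) n
  constructor
  · have := isProbabilityMeasure_betaGaussian (β := β) (by linarith)
    have h := lintegral_truncWeight_mul hβ α n (f := fun _ => 1) measurable_const
    simp only [mul_one, lintegral_const, measure_univ] at h
    rw [h]
    exact hprod.trans (ENNReal.ofReal_le_ofReal (by linarith))
  · calc ∫⁻ y, ENNReal.ofReal (truncWeight α n y * Real.exp (α n * |y n|) * y n ^ 2)
          ∂(betaGaussianProd β)
        = ∫⁻ y, ENNReal.ofReal (truncWeight α n y) *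
            ENNReal.ofReal (y n ^ 2 * Real.exp (α n * |y n|)) ∂(betaGaussianProd β) := by
          refine lintegral_congr fun y => ?_
          rw [← ENNReal.ofReal_mul (truncWeight_pos α n y).le]
          congr 1
          ring
      _ ≤ ENNReal.ofReal P * ENNReal.ofReal K := by
          rw [lintegral_truncWeight_mul hβ α n
            (f := fun x => ENNReal.ofReal (x ^ 2 * Real.exp (α n * |x|))) (by fun_prop)]
          gcongr
          exact (hmom β hβ (α n) (hα n) (hle n)).2
      _ ≤ _ := by
          rw [← ENNReal.ofReal_mul hP0]
          exact ENNReal.ofReal_le_ofReal (by linarith)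

theorem integrable_truncWeight {α : ℕ → ℝ} {β E : ℝ} {n : ℕ}
    (h : ∫⁻ y, ENNReal.ofReal (truncWeight α n y) ∂(betaGaussianProd β) ≤ ENNReal.ofReal E) :
    Integrable (truncWeight α n) (betaGaussianProd β) := by
  refine ⟨(measurable_truncWeight α n).aestronglyMeasurable, ?_⟩
  rw [hasFiniteIntegral_iff_ofReal (Eventually.of_forall fun y => (truncWeight_pos α n y).le)]
  exact h.trans_lt ENNReal.ofReal_lt_top

/-- If the truncated weights have bounded expectations, then they have a common integrable
majorant and `U_α` has full measure. -/
theorem exists_integrable_majorant {α : ℕ → ℝ} (hα : ∀ j, 0 ≤ α j) {β E : ℝ}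
    (h : ∀ n, ∫⁻ y, ENNReal.ofReal (truncWeight α n y) ∂(betaGaussianProd β) ≤
      ENNReal.ofReal E) :
    (∃ D : (ℕ → ℝ) → ℝ, Integrable D (betaGaussianProd β) ∧
      ∀ᵐ y ∂(betaGaussianProd β), ∀ n, truncWeight α n y ≤ D y) ∧
    ∀ᵐ y ∂(betaGaussianProd β), y ∈ weightedSet α := by
  set W : (ℕ → ℝ) → ENNReal := fun y => ⨆ n, ENNReal.ofReal (truncWeight α n y) with hW
  have hWm : Measurable W := .iSup fun n => (measurable_truncWeight α n).ennreal_ofReal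
  -- Monotone convergence: the weights increase with `n`.
  have hWint : ∫⁻ y, W y ∂(betaGaussianProd β) ≠ ⊤ := by
    rw [lintegral_iSup (fun n => (measurable_truncWeight α n).ennreal_ofReal)
      (fun m n hmn y => ENNReal.ofReal_le_ofReal (truncWeight_mono hα y hmn))]
    exact ((iSup_le h).trans_lt ENNReal.ofReal_lt_top).ne
  have hfin : ∀ᵐ y ∂(betaGaussianProd β), ∀ n, truncWeight α n y ≤ (W y).toReal := by
    filter_upwards [ae_lt_top hWm hWint] with y hy n
    rw [← ENNReal.ofReal_le_iff_le_toReal hy.ne]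
    exact le_iSup (fun n => ENNReal.ofReal (truncWeight α n y)) n
  refine ⟨⟨fun y => (W y).toReal,
    integrable_toReal_of_lintegral_ne_top hWm.aemeasurable hWint, hfin⟩, ?_⟩
  filter_upwards [hfin] with y hy
  refine summable_of_sum_range_le (c := (W y).toReal)
    (fun j => mul_nonneg (hα j) (abs_nonneg _)) fun n => ?_
  -- Since `1 + x ≤ exp x`, the finite supremum of the weights bounds all partial sums of `α j * |y
  -- j|`.
  have h1 : _ ≤ truncWeight α n y := Real.add_one_le_exp _
  linarith [hy n]

theorem measurePreserving_update_neg {β : ℝ} (hβ : 1 ≤ β) (n : ℕ) :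
    MeasurePreserving (fun y : ℕ → ℝ => Function.update y n (-y n))
      (betaGaussianProd β) (betaGaussianProd β) := by
  have := isProbabilityMeasure_betaGaussian (β := β) (by linarith)
  have hf : ∀ j : ℕ, Measurable (if j = n then fun x : ℝ => -x else id) := fun j => by
    split_ifs <;> fun_prop
  have heq : (fun y : ℕ → ℝ => Function.update y n (-y n)) =
      fun y j => (if j = n then fun x : ℝ => -x else id) (y j) := by
    ext y j
    by_cases hj : j = n
    · subst hj
      simp
    · simp [hj]
  rw [heq]
  refine ⟨by fun_prop, ?_⟩
  unfold betaGaussianProd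
  rw [Measure.infinitePi_map_pi _ hf]
  congr 1
  ext1 j
  split_ifs
  · exact betaGaussian_map_neg β
  · exact Measure.map_id

/-! ### Second differences and the cost of one more variable. -/

section

variable {X : Type*} [NormedAddCommGroup X] [NormedSpace ℝ X]

/-- The even function `u t + u (-t)` has derivative `u' t - u' (-t)`, of norm at most `2 * M * x` on
`[0, x)`. Two mean value inequalities suffice, which also work for vector values. -/
theorem norm_symm_second_difference_le {u : ℝ → X} (hu : ContDiff ℝ 2 u) {x M : ℝ}
    (hM : ∀ t, |t| ≤ |x| → ‖deriv (deriv u) t‖ ≤ M) :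
    ‖u x + u (-x) - (2 : ℝ) • u 0‖ ≤ 2 * M * x ^ 2 := by
  wlog hx : 0 ≤ x generalizing x
  · have h := this (x := -x) (by simpa using hM) (by linarith)
    rwa [neg_neg, add_comm (u (-x)), neg_sq] at h
  rw [abs_of_nonneg hx] at hM
  have hM0 : 0 ≤ M := (norm_nonneg _).trans (hM 0 (by simpa using hx))
  have hu1 : ∀ t, HasDerivAt u (deriv u t) t := fun t =>
    (hu.differentiable (by norm_num) t).hasDerivAt
  have hu' : ContDiff ℝ 1 (deriv u) := by
    have h : ContDiff ℝ (1 + 1) u := by simpa [one_add_one_eq_two] using hu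
    exact (contDiff_succ_iff_deriv.mp h).2.2
  have hu2 : ∀ t, DifferentiableAt ℝ (deriv u) t := hu'.differentiable (by norm_num)
  have hw : ∀ t, HasDerivAt (fun t => u t + u (-t)) (deriv u t - deriv u (-t)) t := fun t => by
    have h := (hu1 (-t)).scomp t (hasDerivAt_neg t)
    rw [neg_one_smul] at h
    rw [sub_eq_add_neg]
    exact (hu1 t).add h
  have hbound : ∀ t ∈ Set.Ico 0 x, ‖deriv u t - deriv u (-t)‖ ≤ 2 * M * x := fun t ht => by
    have h := (convex_Icc (-x) x).norm_image_sub_le_of_norm_deriv_le (𝕜 := ℝ) (f := deriv u)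
      (fun r _ => hu2 r) (fun r hr => hM r (abs_le.mpr hr))
      (x := -t) (y := t) ⟨by linarith [ht.2], by linarith [ht.1]⟩ ⟨by linarith [ht.1], ht.2.le⟩
    refine h.trans ?_
    rw [Real.norm_eq_abs, abs_of_nonneg (by linarith [ht.1])]
    nlinarith [ht.2]
  have h := norm_image_sub_le_of_norm_deriv_le_segment'
    (fun t _ => (hw t).hasDerivWithinAt) hbound x ⟨hx, le_rfl⟩
  rw [neg_zero, ← two_smul ℝ (u 0)] at h
  calc _ ≤ 2 * M * x * (x - 0) := h
    _ = 2 * M * x ^ 2 := by ring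

theorem truncateSeq_update_add_smul_single (n : ℕ) (y : ℕ → ℝ) (x t : ℝ) :
    truncateSeq (n + 1) (Function.update y n x) + t • Pi.single n 1 =
      truncateSeq (n + 1) (Function.update y n (x + t)) := by
  ext j
  by_cases hj : j = n
  · subst hj
    simp [truncateSeq]
  · simp [truncateSeq, hj]

/-- Being an identity of functions of `x`, it can be applied twice to identify the second derivative
of the section. -/
theorem seqPartial_truncateSeq_update (g : (ℕ → ℝ) → X) (n : ℕ) (y : ℕ → ℝ) :
    (fun x => seqPartial n g (truncateSeq (n + 1) (Function.update y n x))) =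
      deriv fun x => g (truncateSeq (n + 1) (Function.update y n x)) := by
  ext x
  simp only [seqPartial, lineDeriv, truncateSeq_update_add_smul_single]
  rw [deriv_comp_const_add (fun x => g (truncateSeq (n + 1) (Function.update y n x))), add_zero]

theorem mixedPartial_zero (g : (ℕ → ℝ) → X) : mixedPartial 0 g = g := by
  simp [mixedPartial]

theorem mixedPartial_single_two (g : (ℕ → ℝ) → X) (n : ℕ) :
    mixedPartial (Finsupp.single n 2) g = seqPartial n (seqPartial n g) := by
  have h : (Finsupp.toMultiset (Finsupp.single n 2)).sort (· ≤ ·) = List.replicate 2 n := by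
    rw [List.eq_replicate_iff]
    simp [Finsupp.toMultiset_single]
  rw [mixedPartial, h]
  rfl

theorem zero_mem_weightedSet (α : ℕ → ℝ) : (0 : ℕ → ℝ) ∈ weightedSet α := by
  simp [weightedSet, summable_zero]

theorem truncateSeq_eq_replaceFirst (n : ℕ) (y : ℕ → ℝ) :
    truncateSeq n y = replaceFirst n 0 fun i => y i := by
  ext j
  simp [truncateSeq, replaceFirst]

theorem ContDiffInVariables.contDiff_update {m : ℕ} {α : ℕ → ℝ} {g : (ℕ → ℝ) → X}
    (hg : ContDiffInVariables m α g) (n : ℕ) (y : ℕ → ℝ) :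
    ContDiff ℝ m fun x => g (truncateSeq (n + 1) (Function.update y n x)) := by
  simp_rw [truncateSeq_eq_replaceFirst]
  refine (hg 0 (zero_mem_weightedSet α) (n + 1)).comp (contDiff_pi.mpr fun i => ?_)
  by_cases hi : (i : ℕ) = n
  · simpa [hi] using contDiff_fun_id
  · simpa [hi] using contDiff_const

theorem ContDiffInVariables.stronglyMeasurable_truncateSeq {m : ℕ} {α : ℕ → ℝ}
    {g : (ℕ → ℝ) → X} (hg : ContDiffInVariables m α g) (n : ℕ) :
    StronglyMeasurable fun y => g (truncateSeq n y) := by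
  simp_rw [truncateSeq_eq_replaceFirst]
  exact (hg 0 (zero_mem_weightedSet α) n).continuous.stronglyMeasurable.comp_measurable
    (g := fun (y : ℕ → ℝ) (i : Fin n) => y i) (by fun_prop)

theorem ParametricRegularity.norm_truncateSeq_le {m : ℕ} {α b Θ : ℕ → ℝ} {g : (ℕ → ℝ) → X}
    (hg : ParametricRegularity m α b Θ g) (n : ℕ) (y : ℕ → ℝ) :
    ‖g (truncateSeq n y)‖ ≤ Θ 0 * truncWeight α n y := by
  have h := hg.bound _ (truncateSeq_mem_weightedSet α n y) 0 (by simp)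
  simpa [mixedPartial_zero, tprod_exp_truncateSeq] using h

theorem ParametricRegularity.norm_second_deriv_le {m : ℕ} {α b Θ : ℕ → ℝ} {g : (ℕ → ℝ) → X}
    (hg : ParametricRegularity m α b Θ g) (hm : 2 ≤ m) (n : ℕ) (y : ℕ → ℝ) (x : ℝ) :
    ‖deriv (deriv fun x => g (truncateSeq (n + 1) (Function.update y n x))) x‖ ≤
      Θ 2 * b n ^ 2 * (truncWeight α n y * Real.exp (α n * |x|)) := by
  have h := hg.bound _ (truncateSeq_mem_weightedSet α (n + 1) (Function.update y n x))
    (Finsupp.single n 2) (by simpa using hm)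
  rw [tprod_exp_truncateSeq, truncWeight_succ_update, mixedPartial_single_two,
    Finsupp.degree_single, Finsupp.prod_single_index (h := fun j n => b j ^ n) (pow_zero _)] at h
  rw [← seqPartial_truncateSeq_update, ← seqPartial_truncateSeq_update]
  exact h

theorem truncateSeq_succ_update_zero (n : ℕ) (y : ℕ → ℝ) :
    truncateSeq (n + 1) (Function.update y n 0) = truncateSeq n y := by
  ext j
  by_cases hj : j = n
  · subst hj
    simp [truncateSeq]
  · simp only [truncateSeq, Function.update_of_ne hj]
    have : j < n + 1 ↔ j < n := by omega
    simp [this]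

theorem truncateSeq_update_self (n : ℕ) (y : ℕ → ℝ) (x : ℝ) :
    truncateSeq n (Function.update y n x) = truncateSeq n y := by
  ext j
  by_cases hj : j = n
  · subst hj
    simp [truncateSeq]
  · simp [truncateSeq, hj]

/-- Reflecting `y n` leaves `g (truncateSeq n y)` fixed, and this is also the central value of the
section in `y n`. Hence the difference plus its reflection is exactly a symmetric second difference.
-/
theorem ParametricRegularity.norm_symm_difference_le {m : ℕ} {α b Θ : ℕ → ℝ}
    {g : (ℕ → ℝ) → X} (hg : ParametricRegularity m α b Θ g) (hm : 2 ≤ m)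
    (hα : ∀ j, 0 ≤ α j) (hΘ : 0 ≤ Θ 2) (n : ℕ) (y : ℕ → ℝ) :
    ‖g (truncateSeq (n + 1) y) - g (truncateSeq n y) +
        (g (truncateSeq (n + 1) (Function.update y n (-y n))) -
          g (truncateSeq n (Function.update y n (-y n))))‖ ≤
      2 * (Θ 2 * b n ^ 2) * (truncWeight α n y * Real.exp (α n * |y n|) * y n ^ 2) := by
  have h := norm_symm_second_difference_le (x := y n)
    ((hg.contDiff.contDiff_update n y).of_le (by exact_mod_cast hm))
    (M := Θ 2 * b n ^ 2 * (truncWeight α n y * Real.exp (α n * |y n|))) fun t ht =>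
      (hg.norm_second_deriv_le hm n y t).trans <| by
        have := (truncWeight_pos α n y).le
        have := hα n
        gcongr
  rw [truncateSeq_succ_update_zero, Function.update_eq_self, two_smul] at h
  rw [truncateSeq_update_self]
  calc _ = _ := by congr 1; abel
    _ ≤ _ := h
    _ = _ := by ring

theorem ParametricRegularity.integrable_truncateSeq {m : ℕ} {α b Θ : ℕ → ℝ} {g : (ℕ → ℝ) → X}
    (hg : ParametricRegularity m α b Θ g) {β E : ℝ} {n : ℕ}
    (h : ∫⁻ y, ENNReal.ofReal (truncWeight α n y) ∂(betaGaussianProd β) ≤ ENNReal.ofReal E) :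
    Integrable (fun y => g (truncateSeq n y)) (betaGaussianProd β) :=
  ((integrable_truncWeight h).const_mul (Θ 0)).mono'
    (hg.contDiff.stronglyMeasurable_truncateSeq n).aestronglyMeasurable
    (Eventually.of_forall fun y => hg.norm_truncateSeq_le n y)

/-- Activating one further variable changes the expectation only to second order, since the
first-order term is odd. -/
theorem ParametricRegularity.norm_integral_succ_sub_le {m : ℕ} {α b Θ : ℕ → ℝ}
    {g : (ℕ → ℝ) → X} (hg : ParametricRegularity m α b Θ g) (hm : 2 ≤ m)
    (hα : ∀ j, 0 ≤ α j) (hΘ : 0 ≤ Θ 2) {β E : ℝ} (hβ : 1 ≤ β) (hE : 0 ≤ E)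
    (h : ∀ n, ∫⁻ y, ENNReal.ofReal (truncWeight α n y) ∂(betaGaussianProd β) ≤
      ENNReal.ofReal E) (n : ℕ)
    (h2 : ∫⁻ y, ENNReal.ofReal (truncWeight α n y * Real.exp (α n * |y n|) * y n ^ 2)
      ∂(betaGaussianProd β) ≤ ENNReal.ofReal E) :
    ‖∫ y, (g (truncateSeq (n + 1) y) - g (truncateSeq n y)) ∂(betaGaussianProd β)‖ ≤
      Θ 2 * E * b n ^ 2 := by
  set d : (ℕ → ℝ) → X := fun y => g (truncateSeq (n + 1) y) - g (truncateSeq n y) with hd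
  have hdm : StronglyMeasurable d :=
    (hg.contDiff.stronglyMeasurable_truncateSeq (n + 1)).sub
      (hg.contDiff.stronglyMeasurable_truncateSeq n)
  have hdi : Integrable d (betaGaussianProd β) :=
    (hg.integrable_truncateSeq (h (n + 1))).sub (hg.integrable_truncateSeq (h n))
  have hflip := measurePreserving_update_neg hβ n
  have hdi' : Integrable (fun y => d (Function.update y n (-y n))) (betaGaussianProd β) :=
    hflip.integrable_comp_of_integrable hdi
  have hflip_int : ∫ y, d (Function.update y n (-y n)) ∂(betaGaussianProd β) =
      ∫ y, d y ∂(betaGaussianProd β) := by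
    conv_rhs => rw [← hflip.map_eq]
    exact (integral_map hflip.measurable.aemeasurable hdm.aestronglyMeasurable).symm
  have hc : 0 ≤ 2 * (Θ 2 * b n ^ 2) := by positivity
  have hsum : ‖∫ y, (d y + d (Function.update y n (-y n))) ∂(betaGaussianProd β)‖ ≤
      2 * (Θ 2 * b n ^ 2) * E := by
    refine (norm_integral_le_lintegral_norm _).trans
      (ENNReal.toReal_le_of_le_ofReal (by positivity) ?_)
    calc _ ≤ ∫⁻ y, ENNReal.ofReal (2 * (Θ 2 * b n ^ 2)) *
          ENNReal.ofReal (truncWeight α n y * Real.exp (α n * |y n|) * y n ^ 2)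
            ∂(betaGaussianProd β) := by
          refine lintegral_mono fun y => ?_
          rw [← ENNReal.ofReal_mul hc]
          exact ENNReal.ofReal_le_ofReal (hg.norm_symm_difference_le hm hα hΘ n y)
      _ ≤ _ := by
          rw [lintegral_const_mul' _ _ ENNReal.ofReal_ne_top, ENNReal.ofReal_mul hc]
          gcongr
  -- Both integrals agree, so the left side is twice the wanted norm and the factor 2 cancels.
  rw [integral_add hdi hdi', hflip_int, ← two_smul ℝ, norm_smul, Real.norm_two] at hsum
  linarith

theorem norm_integral_truncateSeq_sub_le {g : (ℕ → ℝ) → X} {μ : Measure (ℕ → ℝ)}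
    (hg : ∀ n, Integrable (fun y => g (truncateSeq n y)) μ) {c : ℕ → ℝ}
    (hc : ∀ n, ‖∫ y, (g (truncateSeq (n + 1) y) - g (truncateSeq n y)) ∂μ‖ ≤ c n) (s k : ℕ) :
    ‖∫ y, (g (truncateSeq (k + s) y) - g (truncateSeq s y)) ∂μ‖ ≤
      ∑ i ∈ Finset.range k, c (i + s) := by
  have h : ∫ y, (g (truncateSeq (k + s) y) - g (truncateSeq s y)) ∂μ =
      ∑ i ∈ Finset.range k,
        ∫ y, (g (truncateSeq (i + s + 1) y) - g (truncateSeq (i + s) y)) ∂μ := by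
    simp_rw [integral_sub (hg _) (hg _)]
    have := Finset.sum_range_sub (fun i => ∫ y, g (truncateSeq (i + s) y) ∂μ) k
    simp only [zero_add, add_right_comm _ 1 s] at this
    exact this.symm
  rw [h]
  exact (norm_sum_le _ _).trans (Finset.sum_le_sum fun i _ => hc _)

end

/-! ### The tail of `b ^ 2` and the conclusion. -/

/-- Stechkin-type tail estimate for nonincreasing `p`-summable sequences. -/
theorem sum_sq_tail_le {p : ℝ} (hp0 : 0 < p) (hp2 : p ≤ 2) {b : ℕ → ℝ} (hb : ∀ j, 0 ≤ b j)
    (hanti : Antitone b) (hsum : Summable fun j => b j ^ p) {s : ℕ} (hs : 1 ≤ s) (k : ℕ) :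
    ∑ i ∈ Finset.range k, b (i + s) ^ 2 ≤
      (∑' j, b j ^ p) ^ (2 / p) * (s : ℝ) ^ (-2 / p + 1) := by
  set S := ∑' j, b j ^ p with hS
  have hbp : ∀ j, 0 ≤ b j ^ p := fun j => Real.rpow_nonneg (hb j) p
  have hS0 : 0 ≤ S := tsum_nonneg hbp
  have hs0 : (0 : ℝ) < s := by exact_mod_cast hs
  -- By monotonicity the first `s` terms of the series are each at least `b (i + s) ^ p`.
  have hle : ∀ i, b (i + s) ^ p ≤ S / s := fun i => by
    rw [le_div_iff₀ hs0]
    calc b (i + s) ^ p * s = ∑ _j ∈ Finset.range s, b (i + s) ^ p := by simp [mul_comm]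
      _ ≤ ∑ j ∈ Finset.range s, b j ^ p := by
          refine Finset.sum_le_sum fun j hj => Real.rpow_le_rpow (hb _) (hanti ?_) hp0.le
          have := Finset.mem_range.mp hj
          omega
      _ ≤ S := hsum.sum_le_tsum _ fun j _ => hbp j
  have hq : 0 ≤ 2 / p - 1 := by
    rw [sub_nonneg, le_div_iff₀ hp0]
    linarith
  -- Split off one factor `b ^ p` to be summed; the remaining power `2 / p - 1` of `b ^ p` produces
  -- the decay in `s`.
  have hterm : ∀ i, b (i + s) ^ 2 ≤ (S / s) ^ (2 / p - 1) * b (i + s) ^ p := fun i => by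
    calc b (i + s) ^ 2 = (b (i + s) ^ p) ^ (2 / p - 1 + 1) := by
          rw [← Real.rpow_mul (hb _), sub_add_cancel, mul_div_cancel₀ _ hp0.ne']
          norm_cast
      _ = (b (i + s) ^ p) ^ (2 / p - 1) * b (i + s) ^ p := by
          rw [Real.rpow_add_of_nonneg (hbp _) hq zero_le_one, Real.rpow_one]
      _ ≤ _ := by
          gcongr
          · exact hbp _
          · exact hbp _
          · exact hle i
  calc ∑ i ∈ Finset.range k, b (i + s) ^ 2
      ≤ ∑ i ∈ Finset.range k, (S / s) ^ (2 / p - 1) * b (i + s) ^ p :=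
        Finset.sum_le_sum fun i _ => hterm i
    _ = (S / s) ^ (2 / p - 1) * ∑ i ∈ Finset.range k, b (i + s) ^ p := by rw [Finset.mul_sum]
    _ ≤ (S / s) ^ (2 / p - 1) * S := by
        gcongr
        refine le_trans ?_ (hsum.sum_le_tsum ((Finset.range k).image (· + s)) fun j _ => hbp j)
        rw [Finset.sum_image fun i _ j _ hij => by simpa using hij]
    _ = S ^ (2 / p) * (s : ℝ) ^ (-2 / p + 1) := by
        rw [Real.div_rpow hS0 hs0.le, div_eq_mul_inv, ← Real.rpow_neg hs0.le, mul_right_comm]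
        congr 1
        · conv_rhs => rw [← sub_add_cancel (2 / p) 1]
          rw [Real.rpow_add_of_nonneg hS0 hq zero_le_one, Real.rpow_one]
        · congr 1
          ring

theorem mainTheorem3 {X : Type*} [NormedAddCommGroup X] [NormedSpace ℝ X] [CompleteSpace X]
    [TopologicalSpace.SeparableSpace X]
    (p : ℝ) (hp0 : 0 < p) (hp1 : p < 1)
    (α b Θ : ℕ → ℝ)
    (hα_nonneg : ∀ j, 0 ≤ α j) (hα_summable : Summable α) (hα_sup : ⨆ j, |α j| < 1)
    (hb_nonneg : ∀ j, 0 ≤ b j) (hb_anti : Antitone b) (hb_summable : Summable fun j => b j ^ p)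
    (hΘ : ∀ l, 0 ≤ Θ l) :
    ∃ C : ℝ, 0 < C ∧
      ∀ β : ℝ, 1 ≤ β →
      ∀ g : (ℕ → ℝ) → X,
        TruncationConverges β α g →
        ParametricRegularity (⌈1 / (1 - p)⌉₊ + 1) α b Θ g →
        ∀ s : ℕ, 1 ≤ s →
          Integrable (fun y => g y - g (truncateSeq s y)) (betaGaussianProd β) ∧
          ‖∫ y, (g y - g (truncateSeq s y)) ∂(betaGaussianProd β)‖ ≤
            C * (s : ℝ) ^ (-2 / p + 1) ∧
          ∀ G : X →L[ℝ] ℝ,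
            |∫ y, G (g y - g (truncateSeq s y)) ∂(betaGaussianProd β)| ≤
              C * ‖G‖ * (s : ℝ) ^ (-2 / p + 1) := by
  obtain ⟨E, hE, hEβ⟩ := exists_lintegral_truncWeight_le hα_nonneg hα_summable hα_sup
  have hm : 2 ≤ ⌈1 / (1 - p)⌉₊ + 1 := by
    have : 0 < ⌈1 / (1 - p)⌉₊ := Nat.ceil_pos.mpr (one_div_pos.mpr (by linarith))
    omega
  have hΘE : 0 ≤ Θ 2 * E := mul_nonneg (hΘ 2) hE
  have hS : 0 ≤ ∑' j, b j ^ p := tsum_nonneg fun j => Real.rpow_nonneg (hb_nonneg j) p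
  -- The summand 1 keeps the constant positive when `Θ 2` or `b` vanishes.
  refine ⟨Θ 2 * E * (∑' j, b j ^ p) ^ (2 / p) + 1, by positivity, fun β hβ g hconv hg s hs => ?_⟩
  set C := Θ 2 * E * (∑' j, b j ^ p) ^ (2 / p) + 1 with hC
  obtain ⟨⟨D, hDi, hD⟩, hU⟩ := exists_integrable_majorant hα_nonneg fun n => (hEβ β hβ n).1
  have hgi : ∀ n, Integrable (fun y => g (truncateSeq n y)) (betaGaussianProd β) := fun n =>
    hg.integrable_truncateSeq (hEβ β hβ n).1
  have hbound : ∀ k : ℕ, ∀ᵐ y ∂(betaGaussianProd β),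
      ‖g (truncateSeq (k + s) y) - g (truncateSeq s y)‖ ≤ 2 * (Θ 0 * D y) := fun k => by
    filter_upwards [hD] with y hy
    have h1 := (hg.norm_truncateSeq_le (k + s) y).trans
      (mul_le_mul_of_nonneg_left (hy (k + s)) (hΘ 0))
    have h2 := (hg.norm_truncateSeq_le s y).trans (mul_le_mul_of_nonneg_left (hy s) (hΘ 0))
    linarith [norm_sub_le (g (truncateSeq (k + s) y)) (g (truncateSeq s y))]
  have hlim : ∀ᵐ y ∂(betaGaussianProd β),
      Tendsto (fun k : ℕ => g (truncateSeq (k + s) y) - g (truncateSeq s y)) atTop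
        (𝓝 (g y - g (truncateSeq s y))) := by
    filter_upwards [hconv, hU] with y hy hyU
    refine Tendsto.sub_const ?_ _
    refine ((tendsto_iff_norm_sub_tendsto_zero.mpr ?_).comp (tendsto_add_atTop_nat s) :
      Tendsto ((fun n => g (truncateSeq n y)) ∘ (· + s)) atTop (𝓝 (g y)))
    simpa only [norm_sub_rev] using hy hyU
  have hdi : ∀ k : ℕ, Integrable (fun y => g (truncateSeq (k + s) y) - g (truncateSeq s y))
      (betaGaussianProd β) := fun k => (hgi _).sub (hgi _)
  have hDi' : Integrable (fun y => 2 * (Θ 0 * D y)) (betaGaussianProd β) :=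
    (hDi.const_mul _).const_mul _
  have hint : Integrable (fun y => g y - g (truncateSeq s y)) (betaGaussianProd β) := by
    -- Measurability of `g` is not assumed: `g - g_s` inherits it as an almost everywhere limit of
    -- functions of finitely many variables.
    refine hDi'.mono' (aestronglyMeasurable_of_tendsto_ae atTop
      (fun k => (hdi k).aestronglyMeasurable) hlim) ?_
    filter_upwards [hlim, ae_all_iff.mpr hbound] with y hy hyb
    exact le_of_tendsto hy.norm (Eventually.of_forall hyb)
  have hnorm : ‖∫ y, (g y - g (truncateSeq s y)) ∂(betaGaussianProd β)‖ ≤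
      C * (s : ℝ) ^ (-2 / p + 1) := by
    -- The majorant only justifies the limit in `k` and does not enter `C`; the bound on the finite
    -- sums is uniform in `k`.
    refine le_of_tendsto (tendsto_integral_of_dominated_convergence _
      (fun k => (hdi k).aestronglyMeasurable) hDi' hbound hlim).norm
      (Eventually.of_forall fun k => ?_)
    refine (norm_integral_truncateSeq_sub_le hgi (c := fun n => Θ 2 * E * b n ^ 2)
      (fun n => hg.norm_integral_succ_sub_le hm hα_nonneg (hΘ 2) hβ hE
        (fun n => (hEβ β hβ n).1) n (hEβ β hβ n).2) s k).trans ?_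
    rw [← Finset.mul_sum]
    refine (mul_le_mul_of_nonneg_left (sum_sq_tail_le hp0 (by linarith) hb_nonneg hb_anti
      hb_summable hs k) hΘE).trans ?_
    rw [← mul_assoc]
    gcongr
    linarith
  refine ⟨hint, hnorm, fun G => ?_⟩
  rw [G.integral_comp_comm hint, ← Real.norm_eq_abs]
  calc _ ≤ ‖G‖ * ‖∫ y, (g y - g (truncateSeq s y)) ∂(betaGaussianProd β)‖ := G.le_opNorm _
    _ ≤ ‖G‖ * (C * (s : ℝ) ^ (-2 / p + 1)) := by gcongr
    _ = _ := by ring
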